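/- Let $\tilde\Lambda$ be the epicyclic category: its objects are the integers $n\ge 0$; a morphism $n\to m$ of degree $a\in\mathbb N^\times=\{1,2,\dots\}$ is a non-decreasing map $\phi:\mathbb Z\to\mathbb Z$ with $\phi(x+n+1)=\phi(x)+a(m+1)$ for all $x$, taken modulo the relation $\phi\sim\phi'\iff\exists k\in\mathbb Z,\ \phi'=\phi+k(m+1)$; composition is composition of maps. Let $\mathrm{Mod}$ denote the degree, viewed as a functor $\tilde\Lambda^{\rm o}\to\mathbb N^\times$; the morphisms of degree $1$ form the cyclic category $\Lambda\subset\tilde\Lambda$. For $n\ge 0$, $s\ge 1$ let $\mathrm{Id}_n^s: s(n+1)-1\to n$ be the morphism of degree $s$ given by the identity map of $\mathbb Z$, and $\mathrm{Id}_n^{s,{\rm o}}: n\to s(n+1)-1$ the corresponding morphism of $\tilde\Lambda^{\rm o}$. Let $\mathcal{RF}$ be the category whose objects are the integers $a>0$, with $\mathrm{Hom}(a,b)=\{f_{r,s}\mid r,s\in\mathbb N^\times,\ a=rbs\}$, $f_{r,s}\circ f_{p,q}=f_{rp,sq}$, and let $\mathrm{Fr}(f_{r,s})=s$. The pericyclic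 category $\Pi$ is the subcategory of $\tilde\Lambda^{\rm o}\times\mathcal{RF}$ with the same objects $(n,a)$ and with morphisms the pairs $(h,f)$ such that $\mathrm{Fr}(f)=\mathrm{Mod}(h)$. Let $\chi(n,s,d)=(\mathrm{Id}_n^{s,{\rm o}},f_{1,s}):(n,sd)\to(s(n+1)-1,d)$, let $W$ be the class of the morphisms $\mathrm{Id}\times f_{r,1}:(n,a)\to(n,b)$ of $\Pi$ with $br=a$, and let $\Pi[W^{-1}]$ be the localization of $\Pi$ at $W$. Then there is a unique functor $\theta:\tilde\Lambda^{\rm o}\to\Pi[W^{-1}]$ with $$\theta(n)=(n,1),\qquad \theta(\ell)=\ell\times f_{1,1}\ \text{ for every } \ell \text{ in } \Lambda^{\rm o},\qquad \theta(\mathrm{Id}_n^{s,{\rm o}})=\chi(n,s,1)\circ f_{s,1}^{-1}$$ for all $n\ge 0$, $s\ge 1$, where $f_{s,1}$ stands for $\mathrm{Id}\times f_{s,1}:(n,s)\to(n,1)$, and $\theta$ is an equivalence of categories. Consequently, restriction along $\theta$ is an equivalence from the category of covariant functors $\Pi[W^{-1}]\to\mathfrak{Sets}$ to the category of epicyclic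 sets in the sense of Burghelea and Fiedorowicz, i.e. of covariant functors $\tilde\Lambda^{\rm o}\to\mathfrak{Sets}$. -/

import Mathlib

open CategoryTheory Opposite

universe u

/-! ### The epicyclic category -/

/-- Objects of the epicyclic category: one object for each `n ≥ 0`. The object `n` stands for the
projective space of the `ℤ_max`-module `E_{n+1}`, i.e. for `ℤ` with the translation by `n + 1`. -/
@[ext]
structure EpicyclicCat where
  n : ℕ

namespace EpicyclicCat

/-- Non-decreasing maps `φ : ℤ → ℤ` with `φ (x + (n+1)) = φ x + a (m+1)`, for an integer `a > 0`
(the semilinear maps `E_{n+1} → E_{m+1}` twisted by the Frobenius of exponent `a`). -/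
@[ext]
structure PreHom (X Y : EpicyclicCat) where
  toFun : ℤ → ℤ
  deg : ℕ+
  monotone : Monotone toFun
  map_add : ∀ x : ℤ, toFun (x + (X.n + 1)) = toFun x + (deg : ℤ) * (Y.n + 1)

/-- The identity map. -/
def PreHom.id (X : EpicyclicCat) : PreHom X X where
  toFun x := x
  deg := 1
  monotone := monotone_id
  map_add x := by simp

theorem PreHom.map_add_mul {X Y : EpicyclicCat} (f : PreHom X Y) (k x : ℤ) :
    f.toFun (x + k * (X.n + 1)) = f.toFun x + k * ((f.deg : ℤ) * (Y.n + 1)) := by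
  induction k using Int.induction_on with
  | zero => simp
  | succ i ih =>
    have h := f.map_add (x + i * (X.n + 1))
    rw [ih] at h
    rw [show x + ((i : ℤ) + 1) * (X.n + 1) = x + i * (X.n + 1) + (X.n + 1) by ring, h]
    ring
  | pred i ih =>
    have h := f.map_add (x + (-(i : ℤ) - 1) * (X.n + 1))
    rw [show x + (-(i : ℤ) - 1) * (X.n + 1) + (X.n + 1) = x + -(i : ℤ) * (X.n + 1) by ring, ih] at h
    linarith

/-- Composition of maps: first `f`, then `g`. -/
def PreHom.comp {X Y Z : EpicyclicCat} (f : PreHom X Y) (g : PreHom Y Z) : PreHom X Z where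
  toFun x := g.toFun (f.toFun x)
  deg := g.deg * f.deg
  monotone := g.monotone.comp f.monotone
  map_add x := by
    rw [f.map_add, g.map_add_mul]
    push_cast
    ring

/-- Projective equivalence: `φ' = φ + k (m+1)` for some integer `k`. -/
instance preHomSetoid (X Y : EpicyclicCat) : Setoid (PreHom X Y) where
  r f g := ∃ k : ℤ, ∀ x, g.toFun x = f.toFun x + k * (Y.n + 1)
  iseqv :=
    { refl := fun _ => ⟨0, fun x => by simp⟩
      symm := by
        rintro f g ⟨k, hk⟩
        exact ⟨-k, fun x => by rw [hk x]; ring⟩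
      trans := by
        rintro f g h ⟨k, hk⟩ ⟨l, hl⟩
        exact ⟨k + l, fun x => by rw [hl x, hk x]; ring⟩ }

theorem PreHom.deg_eq_of_equiv {X Y : EpicyclicCat} {f g : PreHom X Y} (h : f ≈ g) :
    f.deg = g.deg := by
  obtain ⟨k, hk⟩ := h
  have h1 := f.map_add 0
  have h2 := g.map_add 0
  rw [hk, hk, h1] at h2
  have h3 : ((f.deg : ℤ) - (g.deg : ℤ)) * ((Y.n : ℤ) + 1) = 0 := by linarith
  have h4 : ((Y.n : ℤ) + 1) ≠ 0 := by positivity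
  have h5 := (mul_eq_zero.mp h3).resolve_right h4
  exact PNat.coe_injective (by exact_mod_cast sub_eq_zero.mp h5)

theorem PreHom.comp_equiv {X Y Z : EpicyclicCat} {f f' : PreHom X Y} {g g' : PreHom Y Z}
    (hf : f ≈ f') (hg : g ≈ g') : f.comp g ≈ f'.comp g' := by
  obtain ⟨k, hk⟩ := hf
  obtain ⟨l, hl⟩ := hg
  refine ⟨k * g.deg + l, fun x => ?_⟩
  simp only [PreHom.comp]
  rw [hk, hl, g.map_add_mul]
  ring

/-- The epicyclic category `Λ̃`: morphisms `n ⟶ m` are the projective classes of the maps above. -/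
instance category : Category EpicyclicCat where
  Hom X Y := Quotient (preHomSetoid X Y)
  id X := Quotient.mk _ (PreHom.id X)
  comp f g := Quotient.map₂ PreHom.comp
    (fun _ _ hf _ _ hg => PreHom.comp_equiv hf hg) f g
  id_comp f := by
    induction f using Quotient.inductionOn
    exact Quotient.sound ⟨0, fun x => by simp [PreHom.comp, PreHom.id]⟩
  comp_id f := by
    induction f using Quotient.inductionOn
    exact Quotient.sound ⟨0, fun x => by simp [PreHom.comp, PreHom.id]⟩
  assoc f g h := by
    induction f using Quotient.inductionOn
    induction g using Quotient.inductionOn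
    induction h using Quotient.inductionOn
    exact Quotient.sound ⟨0, fun x => by simp [PreHom.comp]⟩

/-- The class of a map. -/
def homMk {X Y : EpicyclicCat} (f : PreHom X Y) : X ⟶ Y := Quotient.mk (preHomSetoid X Y) f

/-- The degree of a morphism of the epicyclic category. -/
def degree {X Y : EpicyclicCat} (f : X ⟶ Y) : ℕ+ :=
  Quotient.lift (fun g : PreHom X Y => g.deg) (fun _ _ h => PreHom.deg_eq_of_equiv h) f

theorem degree_comp {X Y Z : EpicyclicCat} (f : X ⟶ Y) (g : Y ⟶ Z) :
    degree (f ≫ g) = degree g * degree f := by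
  induction f using Quotient.inductionOn
  induction g using Quotient.inductionOn
  rfl

/-- The degree functor `Λ̃ᵒᵖ ⥤ ℕ^×`. -/
def Mod : EpicyclicCatᵒᵖ ⥤ SingleObj ℕ+ where
  obj _ := SingleObj.star ℕ+
  map f := degree f.unop
  map_id _ := rfl
  map_comp f g := (degree_comp g.unop f.unop).trans (mul_comm _ _)

/-- The morphism `Id_n^s : s (n+1) - 1 ⟶ n` of degree `s`, given by the identity map of `ℤ`. -/
def idPow (n : ℕ) (s : ℕ+) : EpicyclicCat.mk (s * (n + 1) - 1) ⟶ EpicyclicCat.mk n :=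
  homMk
    { toFun := fun x => x
      deg := s
      monotone := monotone_id
      map_add := fun x => by
        have h : 1 ≤ (s : ℕ) * (n + 1) := Nat.mul_pos s.pos n.succ_pos
        push_cast [Nat.cast_sub h]
        ring }

end EpicyclicCat

/-- Epicyclic sets (in the sense of Burghelea and Fiedorowicz): covariant functors from the
opposite of the epicyclic category to sets. -/
abbrev EpicyclicSet : Type (u + 1) := EpicyclicCatᵒᵖ ⥤ Type u

/-! ### The category `𝓡𝓕` -/

/-- Objects of `𝓡𝓕`: one object for each integer `a > 0`. -/
@[ext]
structure RFCat where
  a : ℕ+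

namespace RFCat

/-- The morphisms `a ⟶ b`: the symbols `f_{r,s}` with `a = r b s`. -/
@[ext]
structure Hom (X Y : RFCat) where
  r : ℕ+
  s : ℕ+
  eq : X.a = r * Y.a * s

/-- Composition is `f_{r,s} ∘ f_{p,q} = f_{rp,sq}`. -/
instance category : Category RFCat where
  Hom := Hom
  id X := { r := 1, s := 1, eq := by simp }
  comp f g :=
    { r := g.r * f.r
      s := g.s * f.s
      eq := by rw [f.eq, g.eq]; ac_rfl }
  id_comp f := by apply Hom.ext <;> simp
  comp_id f := by apply Hom.ext <;> simp
  assoc f g h := by apply Hom.ext <;> simp [mul_assoc]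

/-- The morphism `f_{r,s} : a ⟶ b`. -/
def f {a b : ℕ+} (r s : ℕ+) (h : a = r * b * s) : RFCat.mk a ⟶ RFCat.mk b :=
  Hom.mk r s h

/-- The functor `Fr : 𝓡𝓕 ⥤ ℕ^×`, `f_{r,s} ↦ s`. -/
def Fr : RFCat ⥤ SingleObj ℕ+ where
  obj _ := SingleObj.star ℕ+
  map f := Hom.s f
  map_id _ := rfl
  map_comp _ _ := rfl

end RFCat

/-! ### The pericyclic category -/

/-- The condition `Fr f = Mod h` on a morphism `(h, f)` of `Λ̃ᵒᵖ × 𝓡𝓕`. -/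
def pericyclicProp : MorphismProperty (EpicyclicCatᵒᵖ × RFCat) :=
  fun _ _ p => (RFCat.Fr.map p.2 : ℕ+) = EpicyclicCat.Mod.map p.1

instance : pericyclicProp.IsMultiplicative where
  id_mem _ := rfl
  comp_mem f g hf hg := by
    change RFCat.Fr.map (f.2 ≫ g.2) = EpicyclicCat.Mod.map (f.1 ≫ g.1)
    rw [Functor.map_comp, Functor.map_comp]
    exact congrArg₂ (fun x y : ℕ+ => y * x) hf hg

/-- The pericyclic category `Π`: the subcategory of `Λ̃ᵒᵖ × 𝓡𝓕` with the same objects and with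
the morphisms `(h, f)` such that `Fr f = Mod h`. -/
abbrev PericyclicCat : Type := WideSubcategory pericyclicProp

namespace PericyclicCat

/-- The object `(n, a)`. -/
def mk (n : ℕ) (a : ℕ+) : PericyclicCat := ⟨(op (EpicyclicCat.mk n), RFCat.mk a)⟩

/-- The morphism `Id × f_{r,1} : (n, a) ⟶ (n, b)`, for `b r = a`. -/
def idProd (n : ℕ) (a b r : ℕ+) (h : b * r = a) : mk n a ⟶ mk n b :=
  ⟨(𝟙 (op (EpicyclicCat.mk n)), RFCat.f r 1 (by rw [← h, mul_one, mul_comm])), rfl⟩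

/-- The class `W` of the morphisms `Id × f_{r,1} : (n, a) ⟶ (n, b)`, for `b r = a`. -/
inductive W : MorphismProperty PericyclicCat
  | intro (n : ℕ) (a b r : ℕ+) (h : b * r = a) : W (idProd n a b r h)

/-- The morphism `ℓ × f_{1,1} : (n, 1) ⟶ (m, 1)`, for `ℓ` of degree one, i.e. in `Λᵒᵖ`. -/
def cyclicProd {n m : ℕ} (ℓ : op (EpicyclicCat.mk n) ⟶ op (EpicyclicCat.mk m))
    (hℓ : EpicyclicCat.Mod.map ℓ = (1 : ℕ+)) : mk n 1 ⟶ mk m 1 :=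
  ⟨(ℓ, RFCat.f 1 1 rfl), hℓ.symm⟩

/-- The morphism `χ(n, s, d) = (Id_n^{s,o}, f_{1,s}) : (n, s d) ⟶ (s (n+1) - 1, d)`. -/
def chi (n : ℕ) (s d : ℕ+) : mk n (s * d) ⟶ mk (s * (n + 1) - 1) d :=
  ⟨((EpicyclicCat.idPow n s).op, RFCat.f 1 s (by rw [one_mul, mul_comm])), rfl⟩

/-- The morphism `χ(n, s, 1) ∘ f_{s,1}⁻¹ : (n, 1) ⟶ (n, s) ⟶ (s (n+1) - 1, 1)` of `Π[W⁻¹]`. -/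
noncomputable def p (n : ℕ) (s : ℕ+) :
    W.Q.obj (mk n 1) ⟶ W.Q.obj (mk (s * (n + 1) - 1) 1) :=
  Localization.Construction.wInv (idProd n (s * 1) 1 s (mul_comm 1 s)) (W.intro _ _ _ _ _) ≫
    W.Q.map (chi n s 1)

/-- The formulas that prescribe the functor `θ : Λ̃ᵒᵖ ⥤ Π[W⁻¹]`: `θ(n) = (n, 1)`,
`θ(ℓ) = ℓ × f_{1,1}` for `ℓ` in `Λᵒᵖ`, and `θ(Id_n^{s,o}) = χ(n, s, 1) ∘ f_{s,1}⁻¹`. -/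
def IsTheta (θ : EpicyclicCatᵒᵖ ⥤ W.Localization) : Prop :=
  ∃ hobj : ∀ n : ℕ, θ.obj (op (EpicyclicCat.mk n)) = W.Q.obj (mk n 1),
    (∀ (n m : ℕ) (ℓ : op (EpicyclicCat.mk n) ⟶ op (EpicyclicCat.mk m))
      (hℓ : EpicyclicCat.Mod.map ℓ = (1 : ℕ+)),
      θ.map ℓ = eqToHom (hobj n) ≫ W.Q.map (cyclicProd ℓ hℓ) ≫ eqToHom (hobj m).symm) ∧
    (∀ (n : ℕ) (s : ℕ+),
      θ.map (EpicyclicCat.idPow n s).op =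
        eqToHom (hobj n) ≫ p n s ≫ eqToHom (hobj (s * (n + 1) - 1)).symm)

/-- Restriction of set-valued functors along `θ : Λ̃ᵒᵖ ⥤ Π[W⁻¹]`, `F ↦ F ∘ θ`. -/
noncomputable def restrict (θ : EpicyclicCatᵒᵖ ⥤ W.Localization) :
    (W.Localization ⥤ Type u) ⥤ EpicyclicSet.{u} :=
  (Functor.whiskeringLeft EpicyclicCatᵒᵖ W.Localization (Type u)).obj θ

end PericyclicCat

/-! A morphism of `Π` between given objects is determined by its component `h` in `Λ̃ᵒᵖ`: the degree
of `h` fixes `s`, and then `a = r b s` fixes `r`. Inverting `W` identifies every `(n, a)` with `(n,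
1)`, so only `Λ̃ᵒᵖ` remains. The key is the square `map_comp_toOne`: through these identifications a
morphism over `h` becomes `thetaMap h`, whatever `a` and `b` are. It yields functoriality of `θ` and
the prescribed formulas, and makes `θ` inverse to the functor induced by the first projection, which
sends `W` to identities. -/

namespace EpicyclicCat

/-- Every morphism of degree `s` of the epicyclic category is a morphism of degree one followed
by `Id_n^s`. -/
theorem exists_eq_comp_idPow {m n : ℕ} (φ : EpicyclicCat.mk m ⟶ EpicyclicCat.mk n) :
    ∃ ψ : EpicyclicCat.mk m ⟶ EpicyclicCat.mk (degree φ * (n + 1) - 1),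
      degree ψ = 1 ∧ φ = ψ ≫ idPow n (degree φ) := by
  induction φ using Quotient.inductionOn with
  | h f =>
    have h : 1 ≤ (f.deg : ℕ) * (n + 1) := Nat.mul_pos f.deg.pos n.succ_pos
    refine ⟨homMk ⟨f.toFun, 1, f.monotone, fun x => ?_⟩, rfl,
      Quotient.sound ⟨0, fun x => by simp [PreHom.comp]⟩⟩
    refine (f.map_add x).trans ?_
    change f.toFun x + _ = f.toFun x + ((1 : ℕ+) : ℤ) * (((f.deg * (n + 1) - 1 : ℕ) : ℤ) + 1)
    push_cast [Nat.cast_sub h]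
    ring

end EpicyclicCat

namespace PericyclicCat

open EpicyclicCat

/-- The first component of a morphism of `Π`. -/
def fst {n m : ℕ} {a b : ℕ+} (f : mk n a ⟶ mk m b) :
    op (EpicyclicCat.mk n) ⟶ op (EpicyclicCat.mk m) :=
  f.hom.1

theorem fst_comp {n m k : ℕ} {a b c : ℕ+} (f : mk n a ⟶ mk m b) (g : mk m b ⟶ mk k c) :
    fst (f ≫ g) = fst f ≫ fst g := rfl

theorem fst_id (n : ℕ) (a : ℕ+) : fst (𝟙 (mk n a)) = 𝟙 _ := rfl

theorem fst_idProd (n : ℕ) (a b r : ℕ+) (h : b * r = a) : fst (idProd n a b r h) = 𝟙 _ := rfl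

/-- A morphism `(h, f_{r,s})` of `Π` is determined by `h`. -/
theorem hom_ext_fst {n m : ℕ} {a b : ℕ+} {f g : mk n a ⟶ mk m b} (h : fst f = fst g) :
    f = g := by
  refine WideSubcategory.hom_ext _ (Prod.ext h ?_)
  have hs : f.hom.2.s = g.hom.2.s := by
    have hf : f.hom.2.s = degree (fst f).unop := f.property
    have hg : g.hom.2.s = degree (fst g).unop := g.property
    rw [hf, hg, h]
  refine RFCat.Hom.ext ?_ hs
  -- Cancellation in `ℕ+` recovers `r` from `a = r b s`.
  have h1 := f.hom.2.eq
  rw [g.hom.2.eq, hs] at h1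
  exact (mul_right_cancel (mul_right_cancel h1)).symm

/-- The morphism `(h, f_{r,s})` of `Π`, where `s` is the degree of `h`. -/
def homMk {n m : ℕ} {a b : ℕ+} (h : op (EpicyclicCat.mk n) ⟶ op (EpicyclicCat.mk m)) (r : ℕ+)
    (e : a = r * b * degree h.unop) : mk n a ⟶ mk m b :=
  ⟨(h, ⟨r, degree h.unop, e⟩), rfl⟩

theorem fst_homMk {n m : ℕ} {a b : ℕ+} (h : op (EpicyclicCat.mk n) ⟶ op (EpicyclicCat.mk m))
    (r : ℕ+) (e : a = r * b * degree h.unop) : fst (homMk h r e) = h := rfl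

theorem exists_eq_mul_degree_fst {n m : ℕ} {a b : ℕ+} (f : mk n a ⟶ mk m b) :
    ∃ r : ℕ+, a = r * b * degree (fst f).unop := by
  refine ⟨f.hom.2.r, ?_⟩
  have hs : f.hom.2.s = degree (fst f).unop := f.property
  rw [← hs]
  exact f.hom.2.eq

/-- The isomorphism of `Π[W⁻¹]` given by `Id × f_{a,1} : (n, a) ⟶ (n, 1)`. -/
noncomputable def toOne (n : ℕ) (a : ℕ+) : W.Q.obj (mk n a) ≅ W.Q.obj (mk n 1) :=
  Localization.Construction.wIso (idProd n a 1 a (one_mul a)) (W.intro _ _ _ _ _)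

theorem toOne_hom (n : ℕ) (a : ℕ+) :
    (toOne n a).hom = W.Q.map (idProd n a 1 a (one_mul a)) := rfl

theorem toOne_one (n : ℕ) : (toOne n 1).hom = 𝟙 _ := by
  rw [toOne_hom, ← W.Q.map_id]
  exact congrArg W.Q.map (hom_ext_fst rfl)

theorem map_idProd_comp_toOne (n : ℕ) (a b r : ℕ+) (h : b * r = a) :
    W.Q.map (idProd n a b r h) ≫ (toOne n b).hom = (toOne n a).hom := by
  rw [toOne_hom, toOne_hom, ← W.Q.map_comp]
  refine congrArg W.Q.map (hom_ext_fst ?_)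
  rw [fst_comp, fst_idProd, fst_idProd, fst_idProd, Category.comp_id]

/-- The morphism `(h, f_{1,s}) ∘ f_{s,1}⁻¹ : (n, 1) ⟶ (m, 1)` of `Π[W⁻¹]`, where `s` is the
degree of `h`. -/
noncomputable def thetaMap {n m : ℕ} (h : op (EpicyclicCat.mk n) ⟶ op (EpicyclicCat.mk m)) :
    W.Q.obj (mk n 1) ⟶ W.Q.obj (mk m 1) :=
  (toOne n (degree h.unop)).inv ≫ W.Q.map (homMk (b := 1) h 1 (by simp))

/-- With `s` the degree of `h`, `f_{a,1}` factors through `(n, s)`, where it meets the inverse in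
`thetaMap h`; what is left is an equality in `Π`, visible on first components. -/
theorem map_comp_toOne {n m : ℕ} {a b : ℕ+} (f : mk n a ⟶ mk m b) :
    W.Q.map f ≫ (toOne m b).hom = (toOne n a).hom ≫ thetaMap (fst f) := by
  obtain ⟨r, hr⟩ := exists_eq_mul_degree_fst f
  rw [← map_idProd_comp_toOne n a _ (r * b) (by rw [mul_comm, hr]), thetaMap, Category.assoc,
    Iso.hom_inv_id_assoc, toOne_hom, ← W.Q.map_comp, ← W.Q.map_comp]
  refine congrArg W.Q.map (hom_ext_fst ?_)
  rw [fst_comp, fst_comp, fst_idProd, fst_idProd, fst_homMk, Category.comp_id, Category.id_comp]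

theorem thetaMap_id (n : ℕ) : thetaMap (𝟙 (op (EpicyclicCat.mk n))) = 𝟙 _ := by
  have h := map_comp_toOne (𝟙 (mk n 1))
  rw [toOne_one, W.Q.map_id, Category.id_comp, Category.id_comp, fst_id] at h
  exact h.symm

theorem thetaMap_comp {n m k : ℕ} (h : op (EpicyclicCat.mk n) ⟶ op (EpicyclicCat.mk m))
    (g : op (EpicyclicCat.mk m) ⟶ op (EpicyclicCat.mk k)) :
    thetaMap (h ≫ g) = thetaMap h ≫ thetaMap g := by
  -- The source index is the product of the degrees, so that `h` lifts to end at `(m, degree g)`,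
  -- where the lift of `g` to `(k, 1)` begins.
  have hF := map_comp_toOne (homMk (a := degree g.unop * degree h.unop) h 1 (by rw [one_mul]))
  have hG := map_comp_toOne (homMk (a := degree g.unop) (b := 1) g 1 (by simp))
  have hFG := map_comp_toOne
    (homMk (a := degree g.unop * degree h.unop) (b := degree g.unop) h 1 (by rw [one_mul]) ≫
      homMk (b := 1) g 1 (by simp))
  rw [W.Q.map_comp, Category.assoc, hG, ← Category.assoc, hF, Category.assoc, fst_comp,
    fst_homMk, fst_homMk] at hFG
  exact ((cancel_epi _).1 hFG).symm

/-- The functor `θ : Λ̃ᵒᵖ ⥤ Π[W⁻¹]`. -/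
noncomputable def theta : EpicyclicCatᵒᵖ ⥤ W.Localization where
  obj X := W.Q.obj (mk X.unop.n 1)
  map h := thetaMap h
  map_id X := thetaMap_id X.unop.n
  map_comp h g := thetaMap_comp h g

theorem theta_isTheta : IsTheta theta := by
  refine ⟨fun _ => rfl, fun n m ℓ hℓ => ?_, fun n s => ?_⟩
  · have h := map_comp_toOne (cyclicProd ℓ hℓ)
    rw [toOne_one, toOne_one, Category.comp_id, Category.id_comp] at h
    simpa using! h.symm
  · have h := map_comp_toOne (chi n s 1)
    rw [toOne_one, Category.comp_id, ← Iso.inv_comp_eq] at h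
    have hp : p n s = (toOne n (s * 1)).inv ≫ W.Q.map (chi n s 1) := by
      -- The exponents `s` and `s * 1` are equal but not syntactically so.
      have e : idProd n (s * 1) 1 s (mul_comm 1 s) = idProd n (s * 1) 1 (s * 1) (one_mul _) :=
        hom_ext_fst rfl
      simp only [p, e]
      rfl
    simpa using! (hp.trans h).symm

/-- The prescribed values cover degree one and the `Id_n^s`, which together generate `Λ̃`. -/
theorem IsTheta.eq {θ θ' : EpicyclicCatᵒᵖ ⥤ W.Localization} (h : IsTheta θ) (h' : IsTheta θ') :
    θ' = θ := by
  obtain ⟨o, h1, h2⟩ := h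
  obtain ⟨o', h1', h2'⟩ := h'
  refine CategoryTheory.Functor.ext (fun X => (o' X.unop.n).trans (o X.unop.n).symm) ?_
  rintro ⟨⟨n⟩⟩ ⟨⟨m⟩⟩ φ
  obtain ⟨ψ, hψ, hφ⟩ := exists_eq_comp_idPow φ.unop
  have hφ' : φ = (idPow n (degree φ.unop)).op ≫ ψ.op := Quiver.Hom.unop_inj hφ
  rw [hφ', θ.map_comp, θ'.map_comp, h2, h2', h1 _ _ ψ.op hψ, h1' _ _ ψ.op hψ]
  simp

/-- The first projection `Π ⥤ Λ̃ᵒᵖ`. -/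
def fstFunctor : PericyclicCat ⥤ EpicyclicCatᵒᵖ where
  obj X := X.obj.1
  map f := f.hom.1

theorem fstFunctor_inverts : W.IsInvertedBy fstFunctor := by
  rintro _ _ _ ⟨n, a, b, r, h⟩
  exact inferInstanceAs (IsIso (𝟙 (op (EpicyclicCat.mk n))))

/-- The functor `Π[W⁻¹] ⥤ Λ̃ᵒᵖ` induced by the first projection. -/
noncomputable def proj : W.Localization ⥤ EpicyclicCatᵒᵖ :=
  Localization.Construction.lift fstFunctor fstFunctor_inverts

/-- The functor `proj` extends the first projection. -/
noncomputable def QCompProjIso : W.Q ⋙ proj ≅ fstFunctor :=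
  eqToIso (Localization.Construction.fac _ _)

/-- The isomorphism `(n, a) ≅ (n, 1)`, natural in the object `(n, a)` of `Π`. -/
noncomputable def QIso : W.Q ≅ fstFunctor ⋙ theta :=
  NatIso.ofComponents (fun X => toOne X.obj.1.unop.n X.obj.2.a) (fun f => map_comp_toOne f)

/-- The functor `θ` is a section of `proj` up to isomorphism. -/
noncomputable def thetaCompProjIso : theta ⋙ proj ≅ 𝟭 EpicyclicCatᵒᵖ :=
  NatIso.ofComponents (fun X => QCompProjIso.app (mk X.unop.n 1)) (by
    rintro ⟨⟨n⟩⟩ ⟨⟨m⟩⟩ h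
    change proj.map (thetaMap h) ≫ QCompProjIso.hom.app (mk m 1) =
      QCompProjIso.hom.app (mk n 1) ≫ h
    have e1 := QCompProjIso.hom.naturality
      (homMk (a := degree h.unop) (b := 1) h 1 (by simp))
    have e2 := QCompProjIso.hom.naturality
      (idProd n (degree h.unop) 1 (degree h.unop) (one_mul _))
    have e3 : (toOne n (degree h.unop)).hom ≫ thetaMap h =
        W.Q.map (homMk (b := 1) h 1 (by simp)) := by
      rw [thetaMap, Iso.hom_inv_id_assoc]
    -- Precomposing with this isomorphism removes the formal inverse from `thetaMap h`, leaving
    -- images of morphisms of `Π`.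
    refine (cancel_epi (proj.map (toOne n (degree h.unop)).hom)).1 ?_
    rw [← Functor.map_comp_assoc, e3]
    refine e1.trans (Eq.trans ?_ ((congrArg (· ≫ h) e2.symm).trans (Category.assoc _ _ _)))
    exact (congrArg (· ≫ h) (Category.comp_id _)).symm)

/-- The equivalence `θ : Λ̃ᵒᵖ ≌ Π[W⁻¹]`. -/
noncomputable def thetaEquivalence : EpicyclicCatᵒᵖ ≌ W.Localization :=
  CategoryTheory.Equivalence.mk theta proj thetaCompProjIso.symm
    -- An isomorphism of functors on `Π[W⁻¹]` is determined by its restriction to `Π`, here `QIso`.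
    (Localization.liftNatIso W.Q W W.Q (fstFunctor ⋙ theta) (𝟭 _) (proj ⋙ theta)
      QIso (h₂ := ⟨Functor.isoWhiskerRight QCompProjIso theta⟩)).symm

end PericyclicCat

theorem mainTheorem1 :
    ∃ θ : EpicyclicCatᵒᵖ ⥤ PericyclicCat.W.Localization,
      PericyclicCat.IsTheta θ ∧
      (∀ θ' : EpicyclicCatᵒᵖ ⥤ PericyclicCat.W.Localization, PericyclicCat.IsTheta θ' → θ' = θ) ∧
      θ.IsEquivalence ∧
      (PericyclicCat.restrict.{u} θ).IsEquivalence :=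
  ⟨PericyclicCat.theta, PericyclicCat.theta_isTheta,
    fun _ h => PericyclicCat.theta_isTheta.eq h,
    PericyclicCat.thetaEquivalence.isEquivalence_functor,
    -- `congrLeft` precomposes with the inverse of `θ`, so restriction along `θ` is its inverse
    -- functor.
    (PericyclicCat.thetaEquivalence.congrLeft (E := Type u)).isEquivalence_inverse⟩
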